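/- **Quantum circuits.** A quantum circuit $\mathfrak C$ is an acyclic oriented bipartite graph with s-nodes and o-nodes. Each s-node $s$ has a dimension $d(s)\in\mathbb N$, at most one incoming arrow and at most one outgoing arrow. Each o-node has an ordered list $\Gamma$ of incoming s-nodes and an ordered nonempty list $\Gamma'$ of outgoing s-nodes, and it is either a unitary operator $U:\mathbb C^{d(\Gamma)}\to\mathbb C^{d(\Gamma')}$, written $\Gamma'=U(\Gamma)$, or a projective measurement with outcome a subspace $p$ of $\mathbb C^{d(\Gamma)}=\mathbb C^{d(\Gamma')}$, written $\Gamma'=\mathrm{Mes}_p(\Gamma)$. Here $d([s_1,\dots,s_n])=d(s_1)\cdots d(s_n)$ (so in both cases $d(\Gamma)=d(\Gamma')$). A slice of $\mathfrak C$ is a finite list of distinct s-nodes no two of which are joined by an oriented path; $\Gamma_{\{\}}$ is the set of members of $\Gamma$, and $\Gamma::\Delta$ is concatenation, with $\mathbb C^{d(\Gamma::\Delta)}=\mathbb C^{d(\Gamma)}\otimes\mathbb C^{d(\Delta)}$. $L_n$ is the lattice of subspaces of $\mathbb C^n$, and $a\mathbin{\&}b=b\wedge(a\vee b^\perp)$.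 **Verification.** The relation $\mathfrak C\vdash\Gamma\Vdash p$ ("$\mathfrak C$ verifies $p$ at $\Gamma$"), for $\Gamma$ a slice of $\mathfrak C$ and $p\in L_{d(\Gamma)}$, is the least one closed under the following rules, in which all the lists at which something is verified are slices of $\mathfrak C$: * (Top) $\Gamma\Vdash\top$. * (Ord) If $\Gamma\Vdash p$ and $p\le q$, then $\Gamma\Vdash q$. * (Meet) If $\Gamma\Vdash p$ and $\Gamma\Vdash q$, then $\Gamma\Vdash p\wedge q$. * (Swap) If $\Gamma::\Delta::\Xi\Vdash p$, then $\Delta::\Gamma::\Xi\Vdash\mathrm{swap}_{\Gamma,\Delta,\Xi}(p)$, where $\mathrm{swap}_{\Gamma,\Delta,\Xi}$ is the unitary operator $x\otimes y\otimes z\mapsto y\otimes x\otimes z$. * (Sas) If $\Gamma::\Delta\Vdash p$ and $\Gamma'=\mathrm{Mes}_q(\Gamma)$ in $\mathfrak C$, then $\Gamma'::\Delta\Vdash p\mathbin{\&}(q\otimes\top)$. * (Uni) If $\Gamma::\Delta\Vdash p$ and $\Gamma'=U(\Gamma)$ in $\mathfrak C$, then $\Gamma'::\Delta\Vdash(U\otimes\mathrm{Id})(p)$.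 * (Tens) If $\Gamma\Vdash p$, then $\Gamma::\Delta\Vdash p\otimes\top$. For a slice $\Gamma$, the epistemic state $k_{\mathfrak C}(\Gamma)$ is the least $p\in L_{d(\Gamma)}$ such that $\mathfrak C\vdash\Gamma\Vdash p$. **Proposition.** Suppose that $\Gamma'=\mathrm{Mes}_p(\Gamma)$ in a circuit $\mathfrak C$, and that $A$ is a slice of $\mathfrak C$ compatible with $\Gamma'$, i.e. there is a slice $\Xi$ of $\mathfrak C$ with $\Gamma'_{\{\}}\cup A_{\{\}}\subseteq\Xi_{\{\}}$. Then there exist lists $\Delta$ and $B$ such that $$\Gamma'::\Delta\text{ and }A::B\text{ are slices of }\mathfrak C\quad\text{and}\quad(\Gamma'::\Delta)_{\{\}}=(A::B)_{\{\}}=\Gamma'_{\{\}}\cup A_{\{\}}.\tag{1}$$ Moreover, for all $\Delta$ and $B$ satisfying (1): $\Gamma::\Delta$ is a slice of $\mathfrak C$; some finite sequence of block swaps $X::Y::Z\mapsto Y::X::Z$ leads from $A::B$ to $\Gamma'::\Delta$; and if $\sigma$ denotes the unitary operator obtained by composing the swap operators of any such sequence, then for all $q\in L_{d(A)}$, $$\mathfrak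 C\vdash A\Vdash q\quad\Longrightarrow\quad k_{\mathfrak C}(\Gamma::\Delta)\mathbin{\&}(p\otimes\top)\le\sigma(q\otimes\top).$$ -/

import Mathlib

/-- The Hilbert space `ℂⁿ`. -/
abbrev Hilb (n : ℕ) : Type := EuclideanSpace ℂ (Fin n)

/-- The orthomodular lattice `L_n` of the subspaces of `ℂⁿ`. -/
abbrev QLat (n : ℕ) : Type := Submodule ℂ (Hilb n)

/-- The Sasaki operator `p & q = q ⊓ (p ⊔ qᗮ)`. -/
noncomputable def sasaki {n : ℕ} (p q : QLat n) : QLat n := q ⊓ (p ⊔ qᗮ)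

/-- The identification of `L_m` with `L_n` when `m = n`. -/
noncomputable def recast {m n : ℕ} (h : m = n) (p : QLat m) : QLat n :=
  p.map (LinearIsometryEquiv.piLpCongrLeft 2 ℂ ℂ (finCongr h)).toLinearEquiv.toLinearMap

/-- The operation carried by an o-node from `ℂᵐ` to `ℂⁿ`: a unitary operator, or a projective
measurement (with its outcome, a subspace). -/
inductive Operation (m n : ℕ) : Type
  | unitary (U : Hilb m ≃ₗᵢ[ℂ] Hilb n) : Operation m n
  | mes (h : m = n) (p : QLat m) : Operation m n

/-- The dimension of a list of s-nodes: the product of the dimensions of its members. -/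
def listDim {S : Type*} (d : S → ℕ) (Γ : List S) : ℕ := (Γ.map d).prod

theorem listDim_append {S : Type*} (d : S → ℕ) (Γ Δ : List S) :
    listDim d Γ * listDim d Δ = listDim d (Γ ++ Δ) := by
  simp [listDim]

theorem listDim_append_congr {S : Type*} (d : S → ℕ) {Γ Γ' : List S}
    (h : listDim d Γ = listDim d Γ') (Δ : List S) :
    listDim d (Γ ++ Δ) = listDim d (Γ' ++ Δ) := by
  rw [← listDim_append, ← listDim_append, h]

/-- The (lexicographic) bijection between pairs of basis indices for `Γ` and `Δ` and basis indices
for `Γ ++ Δ`; it realizes the identification of `ℂ^d(Γ) ⊗ ℂ^d(Δ)` with `ℂ^d(Γ ++ Δ)`. -/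
def pairIdx {S : Type*} (d : S → ℕ) (Γ Δ : List S) :
    Fin (listDim d Γ) × Fin (listDim d Δ) ≃ Fin (listDim d (Γ ++ Δ)) :=
  finProdFinEquiv.trans (finCongr (listDim_append d Γ Δ))

/-- The tensor product `x ⊗ y` of two vectors. -/
noncomputable def tensVec {S : Type*} (d : S → ℕ) {Γ Δ : List S}
    (x : Hilb (listDim d Γ)) (y : Hilb (listDim d Δ)) : Hilb (listDim d (Γ ++ Δ)) :=
  WithLp.toLp 2 fun k => x ((pairIdx d Γ Δ).symm k).1 * y ((pairIdx d Γ Δ).symm k).2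

/-- The tensor product `p ⊗ q` of two subspaces. -/
noncomputable def tens {S : Type*} (d : S → ℕ) {Γ Δ : List S}
    (p : QLat (listDim d Γ)) (q : QLat (listDim d Δ)) : QLat (listDim d (Γ ++ Δ)) :=
  Submodule.span ℂ {z | ∃ x ∈ p, ∃ y ∈ q, z = tensVec d x y}

/-- The operator `T ⊗ Id_Δ`, where `T` goes from `ℂ^d(Γ)` to `ℂ^d(Γ')`: `T` is applied to the
first tensor factor, for each fixed basis index of the second one. -/
noncomputable def tensId {S : Type*} (d : S → ℕ) {Γ Γ' : List S}
    (T : Hilb (listDim d Γ) →ₗ[ℂ] Hilb (listDim d Γ')) (Δ : List S) :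
    Hilb (listDim d (Γ ++ Δ)) →ₗ[ℂ] Hilb (listDim d (Γ' ++ Δ)) where
  toFun x := WithLp.toLp 2 fun k =>
    T (WithLp.toLp 2 fun i => x (pairIdx d Γ Δ (i, ((pairIdx d Γ' Δ).symm k).2)))
      ((pairIdx d Γ' Δ).symm k).1
  map_add' x y := by
    ext k
    have h : ∀ j, (WithLp.toLp 2 fun i => (x + y) (pairIdx d Γ Δ (i, j)) :
        Hilb (listDim d Γ)) = (WithLp.toLp 2 fun i => x (pairIdx d Γ Δ (i, j))) +
        (WithLp.toLp 2 fun i => y (pairIdx d Γ Δ (i, j))) := fun j => by ext i; simp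
    simp only [h, map_add]
    simp
  map_smul' c x := by
    ext k
    have h : ∀ j, (WithLp.toLp 2 fun i => (c • x) (pairIdx d Γ Δ (i, j)) :
        Hilb (listDim d Γ)) = c • (WithLp.toLp 2 fun i => x (pairIdx d Γ Δ (i, j))) :=
      fun j => by ext i; simp
    simp only [h, map_smul]
    simp

/-- The action of the block swap on basis indices: `(i, j, k) ↦ (j, i, k)`. -/
def swapIdx {S : Type*} (d : S → ℕ) (Γ Δ Ξ : List S) :
    Fin (listDim d (Γ ++ Δ ++ Ξ)) ≃ Fin (listDim d (Δ ++ Γ ++ Ξ)) :=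
  (pairIdx d (Γ ++ Δ) Ξ).symm.trans
    ((((pairIdx d Γ Δ).symm.trans
      ((Equiv.prodComm _ _).trans (pairIdx d Δ Γ))).prodCongr (Equiv.refl _)).trans
        (pairIdx d (Δ ++ Γ) Ξ))

/-- The block swap operator, mapping `e_i ⊗ f_j ⊗ g_k` to `f_j ⊗ e_i ⊗ g_k`. -/
noncomputable def swapOp {S : Type*} (d : S → ℕ) (Γ Δ Ξ : List S) :
    Hilb (listDim d (Γ ++ Δ ++ Ξ)) ≃ₗᵢ[ℂ] Hilb (listDim d (Δ ++ Γ ++ Ξ)) :=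
  LinearIsometryEquiv.piLpCongrLeft 2 ℂ ℂ (swapIdx d Γ Δ Ξ)

/-- `SwapPath d Γ Γ' σ`: the unitary operator `σ` is obtained by composing the block swap operators
of some finite sequence of block swaps leading from the list `Γ` to the list `Γ'`. -/
inductive SwapPath {S : Type*} (d : S → ℕ) (Γ : List S) :
    (Γ' : List S) → (Hilb (listDim d Γ) ≃ₗᵢ[ℂ] Hilb (listDim d Γ')) → Prop
  | nil : SwapPath d Γ Γ (LinearIsometryEquiv.refl ℂ _)
  | step (Δ Ξ Θ : List S) (σ : Hilb (listDim d Γ) ≃ₗᵢ[ℂ] Hilb (listDim d (Δ ++ Ξ ++ Θ))) :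
      SwapPath d Γ (Δ ++ Ξ ++ Θ) σ →
        SwapPath d Γ (Ξ ++ Δ ++ Θ) (σ.trans (swapOp d Δ Ξ Θ))

/-- The arrows of the bipartite graph with s-nodes `S`, o-nodes `O` and with the given lists of
incoming and outgoing s-nodes of each o-node. -/
inductive Arrow {S O : Type*} (inputs outputs : O → List S) : S ⊕ O → S ⊕ O → Prop
  | into (s : S) (o : O) : s ∈ inputs o → Arrow inputs outputs (Sum.inl s) (Sum.inr o)
  | out (o : O) (s : S) : s ∈ outputs o → Arrow inputs outputs (Sum.inr o) (Sum.inl s)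

/-- Quantum circuits, with s-nodes `S` and o-nodes `O`. -/
structure QCircuit (S O : Type*) where
  /-- the dimension of each s-node -/
  dim : S → ℕ
  /-- the ordered list of the s-nodes entering an o-node -/
  inputs : O → List S
  /-- the ordered list of the s-nodes leaving an o-node -/
  outputs : O → List S
  /-- the operator of each o-node -/
  op : (o : O) → Operation (listDim dim (inputs o)) (listDim dim (outputs o))
  /-- every operation has at least one outgoing s-node -/
  outputs_ne_nil : ∀ o, outputs o ≠ []
  /-- every s-node has at most one outgoing arrow -/
  inputs_nodup : ∀ o, (inputs o).Nodup
  inputs_unique : ∀ s o o', s ∈ inputs o → s ∈ inputs o' → o = o'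
  /-- every s-node has at most one incoming arrow -/
  outputs_nodup : ∀ o, (outputs o).Nodup
  outputs_unique : ∀ s o o', s ∈ outputs o → s ∈ outputs o' → o = o'
  /-- the graph has no oriented cycle -/
  acyclic : ∀ a, ¬ Relation.TransGen (Arrow inputs outputs) a a

namespace QCircuit

/-- The dimension `d(Γ)`. -/
abbrev sdim {S O : Type*} (C : QCircuit S O) (Γ : List S) : ℕ := listDim C.dim Γ

/-- The node `a` is in the past of the node `b`: there is a finite sequence of arrows from `a`
to `b`. -/
def Past {S O : Type*} (C : QCircuit S O) : S ⊕ O → S ⊕ O → Prop :=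
  Relation.ReflTransGen (Arrow C.inputs C.outputs)

/-- Slices: ordered (finite) sets of mutually incomparable s-nodes. -/
def IsSlice {S O : Type*} (C : QCircuit S O) (Γ : List S) : Prop :=
  Γ.Nodup ∧ ∀ a ∈ Γ, ∀ b ∈ Γ, a ≠ b → ¬ C.Past (Sum.inl a) (Sum.inl b)

/-- The support of a slice. -/
def support {S : Type*} (Γ : List S) : Set S := {s | s ∈ Γ}

/-- The slices `Γ` and `A` are compatible: some slice of `C` contains both of them. -/
def Compatible {S O : Type*} (C : QCircuit S O) (Γ A : List S) : Prop :=
  ∃ Ξ : List S, C.IsSlice Ξ ∧ support Γ ∪ support A ⊆ support Ξ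

/-- `C.IsMes Γ' Γ p`: the circuit `C` contains a measurement o-node `Γ' = Mes_p(Γ)`. -/
inductive IsMes {S O : Type*} (C : QCircuit S O) :
    List S → (Γ : List S) → QLat (C.sdim Γ) → Prop
  | intro (o : O) (h : C.sdim (C.inputs o) = C.sdim (C.outputs o))
      (p : QLat (C.sdim (C.inputs o))) :
      C.op o = Operation.mes h p → IsMes C (C.outputs o) (C.inputs o) p

theorem IsMes.sdim_eq {S O : Type*} {C : QCircuit S O} {Γ' Γ : List S} {p : QLat (C.sdim Γ)}
    (h : C.IsMes Γ' Γ p) : C.sdim Γ = C.sdim Γ' := by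
  cases h with
  | intro o h p _ => exact h

theorem IsMes.sdim_append_eq {S O : Type*} {C : QCircuit S O} {Γ' Γ : List S}
    {p : QLat (C.sdim Γ)} (h : C.IsMes Γ' Γ p) (Δ : List S) :
    C.sdim (Γ ++ Δ) = C.sdim (Γ' ++ Δ) :=
  listDim_append_congr C.dim h.sdim_eq Δ

/-- `C.IsUni Γ' Γ U`: the circuit `C` contains a unitary o-node `Γ' = U(Γ)`. -/
inductive IsUni {S O : Type*} (C : QCircuit S O) :
    (Γ' : List S) → (Γ : List S) → (Hilb (C.sdim Γ) ≃ₗᵢ[ℂ] Hilb (C.sdim Γ')) → Prop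
  | intro (o : O) (U : Hilb (C.sdim (C.inputs o)) ≃ₗᵢ[ℂ] Hilb (C.sdim (C.outputs o))) :
      C.op o = Operation.unitary U → IsUni C (C.outputs o) (C.inputs o) U

/-- Provability of the verification statement "`C` verifies `p` at the slice `Γ`". -/
inductive Verifies {S O : Type*} (C : QCircuit S O) :
    (Γ : List S) → QLat (C.sdim Γ) → Prop
  | top (Γ : List S) : C.IsSlice Γ → Verifies C Γ ⊤
  | ord (Γ : List S) (p q : QLat (C.sdim Γ)) :
      Verifies C Γ p → p ≤ q → Verifies C Γ q
  | meet (Γ : List S) (p q : QLat (C.sdim Γ)) :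
      Verifies C Γ p → Verifies C Γ q → Verifies C Γ (p ⊓ q)
  | swap (Γ Δ Ξ : List S) (p : QLat (C.sdim (Γ ++ Δ ++ Ξ))) :
      Verifies C (Γ ++ Δ ++ Ξ) p →
        Verifies C (Δ ++ Γ ++ Ξ)
          (p.map (swapOp C.dim Γ Δ Ξ).toLinearEquiv.toLinearMap)
  | sas (Γ Γ' Δ : List S) (p : QLat (C.sdim (Γ ++ Δ))) (q : QLat (C.sdim Γ))
      (h : C.IsMes Γ' Γ q) :
      Verifies C (Γ ++ Δ) p → C.IsSlice (Γ' ++ Δ) →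
        Verifies C (Γ' ++ Δ) (recast (h.sdim_append_eq Δ) (sasaki p (tens C.dim q ⊤)))
  | uni (Γ Γ' Δ : List S) (p : QLat (C.sdim (Γ ++ Δ)))
      (U : Hilb (C.sdim Γ) ≃ₗᵢ[ℂ] Hilb (C.sdim Γ')) :
      C.IsUni Γ' Γ U → Verifies C (Γ ++ Δ) p → C.IsSlice (Γ' ++ Δ) →
        Verifies C (Γ' ++ Δ) (p.map (tensId C.dim U.toLinearEquiv.toLinearMap Δ))
  | tens (Γ Δ : List S) (p : QLat (C.sdim Γ)) :
      Verifies C Γ p → C.IsSlice (Γ ++ Δ) → Verifies C (Γ ++ Δ) (tens C.dim p ⊤)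

/-- The epistemic state `k_C(Γ)` of `C` at `Γ`: the least element of `L_d(Γ)` verified at `Γ`. -/
noncomputable def k {S O : Type*} (C : QCircuit S O) (Γ : List S) : QLat (C.sdim Γ) :=
  sInf {p | C.Verifies Γ p}

/-- `k_C(Γ)` is itself verified at `Γ`, so that it is indeed a minimum. -/
theorem isLeast_k {S O : Type*} (C : QCircuit S O) (Γ : List S) (hΓ : C.IsSlice Γ) :
    IsLeast {p | C.Verifies Γ p} (C.k Γ) := by
  obtain ⟨m, hm, hmin⟩ := wellFounded_lt.has_min {p : QLat (C.sdim Γ) | C.Verifies Γ p}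
    ⟨⊤, Verifies.top Γ hΓ⟩
  have hle : ∀ p ∈ {p : QLat (C.sdim Γ) | C.Verifies Γ p}, m ≤ p := by
    intro p hp
    by_contra hn
    exact hmin (m ⊓ p) (Verifies.meet Γ m p hm hp) (inf_lt_left.2 hn)
  have hk : C.k Γ = m := le_antisymm (sInf_le hm) (le_sInf hle)
  rw [hk]
  exact ⟨hm, hle⟩

end QCircuit

/-! Each `ℂ^d(Γ)` is embedded by `iota` in the single commutative ring of polynomials whose
variables are the s-nodes: a basis vector goes to the monomial of its coordinates. Tensor products
become products, swap operators become the identity, and `T ⊗ Id_Δ` becomes one operator `extendOp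
T` that does not depend on `Δ`. Since `p & q` is the image of `p` under the projection onto `q`, a
measurement acts by a linear map just as a unitary does.

The inequality then reads `act o (k(Γ :: Δ)) ≤ q * range (iota B)`, and `Verifies.bounds` proves it
for all `Δ` and `B` by induction on the derivation of `q` at `A`. Only a step through an o-node `u`
has content. If `u = o`, the premise of the step, tensored with `⊤`, is verified at a permutation of
`Γ :: Δ`, hence lies above the epistemic state there (`Verifies.bounds_step_self`). If `u ≠ o`, the
outputs of `u` lie in `Δ`; the epistemic state after `u` is below the image under `u` of the one
before it, the two operators commute (`extendOp_comm`), and the induction hypothesis applies before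
`u` (`Verifies.bounds_step`). -/

section

open MvPolynomial

/-! ### Basis indices as exponent vectors -/

/-- The exponent vector of the basis index `k` of `ℂ^d(Γ)`: the exponent of `s` is the coordinate
of `k` at the s-node `s`. -/
noncomputable def coords {S : Type*} (d : S → ℕ) : List S → ℕ → S →₀ ℕ
  | [], _ => 0
  | s :: Γ, k => Finsupp.single s (k / listDim d Γ) + coords d Γ (k % listDim d Γ)

theorem listDim_cons {S : Type*} (d : S → ℕ) (s : S) (Γ : List S) :
    listDim d (s :: Γ) = d s * listDim d Γ := by
  simp [listDim]

theorem coords_append {S : Type*} (d : S → ℕ) (Γ Δ : List S) {i j : ℕ}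
    (hi : i < listDim d Γ) (hj : j < listDim d Δ) :
    coords d (Γ ++ Δ) (j + listDim d Δ * i) = coords d Γ i + coords d Δ j := by
  induction Γ generalizing i with
  | nil =>
    have : i = 0 := by simpa [listDim] using hi
    simp [this, coords]
  | cons s Γ ih =>
    have hpos : 0 < listDim d Γ := by
      rw [listDim_cons] at hi
      exact Nat.pos_of_ne_zero fun h => by simp [h] at hi
    have h1 : (j + listDim d Δ * i) / listDim d (Γ ++ Δ) = i / listDim d Γ := by
      rw [← listDim_append, mul_comm (listDim d Γ), ← Nat.div_div_eq_div_mul,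
        Nat.add_mul_div_left _ _ (by omega), Nat.div_eq_of_lt hj, zero_add]
    have h2 : (j + listDim d Δ * i) % listDim d (Γ ++ Δ) =
        j + listDim d Δ * (i % listDim d Γ) := by
      rw [← listDim_append, mul_comm (listDim d Γ), Nat.mod_mul,
        Nat.add_mul_div_left _ _ (by omega), Nat.div_eq_of_lt hj, zero_add,
        Nat.add_mul_mod_self_left, Nat.mod_eq_of_lt hj]
    simp only [List.cons_append, coords]
    rw [h1, h2, ih (Nat.mod_lt _ hpos), add_assoc]

theorem coords_eq_zero {S : Type*} (d : S → ℕ) (Γ : List S) (k : ℕ) {s : S} (hs : s ∉ Γ) :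
    coords d Γ k s = 0 := by
  induction Γ generalizing k with
  | nil => rfl
  | cons t Γ ih =>
    simp only [List.mem_cons, not_or] at hs
    simp [coords, ih _ hs.2, Finsupp.single_eq_of_ne hs.1]

/-- When the s-nodes are distinct, each exponent is one mixed-radix digit of the index; a repeated
s-node would only show the sum of its digits. -/
theorem coords_injOn {S : Type*} (d : S → ℕ) {Γ : List S} (hΓ : Γ.Nodup) {i j : ℕ}
    (hi : i < listDim d Γ) (hj : j < listDim d Γ) (h : coords d Γ i = coords d Γ j) : i = j := by
  induction Γ generalizing i j with
  | nil =>
    simp only [listDim, List.map_nil, List.prod_nil] at hi hj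
    omega
  | cons s Γ ih =>
    rw [List.nodup_cons] at hΓ
    have hpos : 0 < listDim d Γ := by
      rw [listDim_cons] at hi
      exact Nat.pos_of_ne_zero fun h => by simp [h] at hi
    have h1 : i / listDim d Γ = j / listDim d Γ := by
      simpa [coords, coords_eq_zero d Γ _ hΓ.1] using DFunLike.congr_fun h s
    have h2 : i % listDim d Γ = j % listDim d Γ := by
      refine ih hΓ.2 (Nat.mod_lt _ hpos) (Nat.mod_lt _ hpos) ?_
      simp only [coords, h1] at h
      exact add_left_cancel h
    rw [← Nat.div_add_mod i (listDim d Γ), h1, h2, Nat.div_add_mod]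

theorem coords_pairIdx {S : Type*} (d : S → ℕ) (Γ Δ : List S)
    (i : Fin (listDim d Γ)) (j : Fin (listDim d Δ)) :
    coords d (Γ ++ Δ) (pairIdx d Γ Δ (i, j)) = coords d Γ i + coords d Δ j := by
  rw [← coords_append d Γ Δ i.2 j.2]
  rfl

/-- Exponent vectors add, so they forget the order of the blocks. This is what makes swaps invisible
in the polynomial ring. -/
theorem coords_swapIdx {S : Type*} (d : S → ℕ) (Γ Δ Ξ : List S)
    (k : Fin (listDim d (Γ ++ Δ ++ Ξ))) :
    coords d (Δ ++ Γ ++ Ξ) (swapIdx d Γ Δ Ξ k) = coords d (Γ ++ Δ ++ Ξ) k := by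
  obtain ⟨⟨l, c⟩, rfl⟩ := (pairIdx d (Γ ++ Δ) Ξ).surjective k
  obtain ⟨⟨a, b⟩, rfl⟩ := (pairIdx d Γ Δ).surjective l
  have h : swapIdx d Γ Δ Ξ (pairIdx d (Γ ++ Δ) Ξ (pairIdx d Γ Δ (a, b), c)) =
      pairIdx d (Δ ++ Γ) Ξ (pairIdx d Δ Γ (b, a), c) := by
    simp only [swapIdx, Equiv.trans_apply, Equiv.symm_apply_apply, Equiv.prodCongr_apply,
      Prod.map_apply, Equiv.prodComm_apply, Prod.swap_prod_mk, Equiv.refl_apply]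
  rw [h]
  simp only [coords_pairIdx, add_comm (coords d Γ a)]

/-! ### Embedding in the polynomial ring -/

/-- The embedding of `ℂ^d(Γ)` into the polynomials over the s-nodes that maps each basis vector to
the monomial of its coordinates. It turns tensor products into products of polynomials. -/
noncomputable def iota {S : Type*} (d : S → ℕ) (Γ : List S) :
    Hilb (listDim d Γ) →ₗ[ℂ] MvPolynomial S ℂ :=
  ∑ k : Fin (listDim d Γ), (monomial (coords d Γ k)).comp (EuclideanSpace.proj k).toLinearMap

theorem iota_apply {S : Type*} (d : S → ℕ) (Γ : List S) (x : Hilb (listDim d Γ)) :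
    iota d Γ x = ∑ k : Fin (listDim d Γ), monomial (coords d Γ k) (x k) := by
  simp [iota]

theorem iota_single {S : Type*} (d : S → ℕ) (Γ : List S) (k : Fin (listDim d Γ)) (c : ℂ) :
    iota d Γ (EuclideanSpace.single k c) = monomial (coords d Γ k) c := by
  classical
  rw [iota_apply, Finset.sum_eq_single k]
  · simp
  · intro j _ hj
    simp [hj]
  · simp

theorem coeff_iota {S : Type*} (d : S → ℕ) {Γ : List S} (hΓ : Γ.Nodup)
    (x : Hilb (listDim d Γ)) (k : Fin (listDim d Γ)) :
    coeff (coords d Γ k) (iota d Γ x) = x k := by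
  classical
  rw [iota_apply, coeff_sum, Finset.sum_eq_single k]
  · simp
  · intro j _ hj
    rw [coeff_monomial, if_neg]
    exact fun h => hj (Fin.ext (coords_injOn d hΓ j.2 k.2 h))
  · simp

theorem iota_injective {S : Type*} (d : S → ℕ) {Γ : List S} (hΓ : Γ.Nodup) :
    Function.Injective (iota d Γ) := by
  intro x y h
  ext k
  rw [← coeff_iota d hΓ, h, coeff_iota d hΓ]

theorem iota_tensVec {S : Type*} (d : S → ℕ) {Γ Δ : List S}
    (x : Hilb (listDim d Γ)) (y : Hilb (listDim d Δ)) :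
    iota d (Γ ++ Δ) (tensVec d x y) = iota d Γ x * iota d Δ y := by
  simp only [iota_apply, Finset.sum_mul_sum]
  rw [← (pairIdx d Γ Δ).sum_comp, Fintype.sum_prod_type]
  simp [coords_pairIdx, tensVec, monomial_mul]

/-! ### Tensor products of vectors, operators and subspaces -/

theorem single_pairIdx {S : Type*} (d : S → ℕ) (Γ Δ : List S)
    (i : Fin (listDim d Γ)) (j : Fin (listDim d Δ)) :
    EuclideanSpace.single (pairIdx d Γ Δ (i, j)) (1 : ℂ) =
      tensVec d (EuclideanSpace.single i 1) (EuclideanSpace.single j 1) := by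
  ext k
  obtain ⟨⟨a, b⟩, rfl⟩ := (pairIdx d Γ Δ).surjective k
  by_cases ha : a = i <;> by_cases hb : b = j <;> simp [tensVec, ha, hb]

/-- Linear maps on `ℂ^d(Γ ++ Δ)` are determined by their values on product vectors. -/
theorem hilb_append_ext {S : Type*} (d : S → ℕ) {Γ Δ : List S} {M : Type*} [AddCommMonoid M]
    [Module ℂ M] {f g : Hilb (listDim d (Γ ++ Δ)) →ₗ[ℂ] M}
    (h : ∀ x y, f (tensVec d x y) = g (tensVec d x y)) : f = g := by
  refine (EuclideanSpace.basisFun _ ℂ).toBasis.ext fun k => ?_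
  obtain ⟨⟨i, j⟩, rfl⟩ := (pairIdx d Γ Δ).surjective k
  simpa [single_pairIdx] using h _ _

theorem tensId_tensVec {S : Type*} (d : S → ℕ) {Γ Γ' : List S}
    (T : Hilb (listDim d Γ) →ₗ[ℂ] Hilb (listDim d Γ')) (Δ : List S)
    (x : Hilb (listDim d Γ)) (y : Hilb (listDim d Δ)) :
    tensId d T Δ (tensVec d x y) = tensVec d (T x) y := by
  ext k
  obtain ⟨⟨a, b⟩, rfl⟩ := (pairIdx d Γ' Δ).surjective k
  have h : (WithLp.toLp 2 fun i => x i * y b : Hilb (listDim d Γ)) = y b • x := by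
    ext i; simp [mul_comm]
  simp [tensId, tensVec, h, mul_comm]

/-- The vector of `ℂ^d(Γ)` obtained by fixing the basis index of the second factor. -/
noncomputable def tensSlice {S : Type*} (d : S → ℕ) (Γ Δ : List S) (j : Fin (listDim d Δ)) :
    Hilb (listDim d (Γ ++ Δ)) →ₗ[ℂ] Hilb (listDim d Γ) where
  toFun x := WithLp.toLp 2 fun i => x (pairIdx d Γ Δ (i, j))
  map_add' x y := by ext i; simp
  map_smul' c x := by ext i; simp

theorem tensSlice_tensVec {S : Type*} (d : S → ℕ) {Γ Δ : List S} (j : Fin (listDim d Δ))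
    (x : Hilb (listDim d Γ)) (y : Hilb (listDim d Δ)) :
    tensSlice d Γ Δ j (tensVec d x y) = y j • x := by
  ext i
  simp [tensSlice, tensVec, mul_comm]

theorem tensSlice_tensId {S : Type*} (d : S → ℕ) {Γ Γ' : List S}
    (T : Hilb (listDim d Γ) →ₗ[ℂ] Hilb (listDim d Γ')) (Δ : List S) (j : Fin (listDim d Δ))
    (x : Hilb (listDim d (Γ ++ Δ))) :
    tensSlice d Γ' Δ j (tensId d T Δ x) = T (tensSlice d Γ Δ j x) := by
  ext i
  simp [tensSlice, tensId]

theorem sum_tensSlice {S : Type*} (d : S → ℕ) {Γ Δ : List S} (x : Hilb (listDim d (Γ ++ Δ))) :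
    ∑ j, tensVec d (tensSlice d Γ Δ j x) (EuclideanSpace.single j 1) = x := by
  classical
  ext k
  obtain ⟨⟨a, b⟩, rfl⟩ := (pairIdx d Γ Δ).surjective k
  simp [tensSlice, tensVec]

/-- Expanding the second factor in its basis tests membership slice by slice; compatibility with
meets and the formula for the projection both follow from this. -/
theorem mem_tens_top {S : Type*} (d : S → ℕ) {Γ Δ : List S} {q : QLat (listDim d Γ)}
    {x : Hilb (listDim d (Γ ++ Δ))} :
    x ∈ tens d q (⊤ : QLat (listDim d Δ)) ↔ ∀ j, tensSlice d Γ Δ j x ∈ q := by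
  constructor
  · intro hx j
    suffices tens d q (⊤ : QLat (listDim d Δ)) ≤ q.comap (tensSlice d Γ Δ j) from this hx
    refine Submodule.span_le.2 ?_
    rintro _ ⟨x, hx, y, -, rfl⟩
    simpa [tensSlice_tensVec] using q.smul_mem _ hx
  · intro h
    rw [← sum_tensSlice d x]
    exact Submodule.sum_mem _ fun j _ => Submodule.subset_span ⟨_, h j, _, trivial, rfl⟩

theorem tens_inf_top {S : Type*} (d : S → ℕ) {Γ Δ : List S} (p q : QLat (listDim d Γ)) :
    tens d (p ⊓ q) (⊤ : QLat (listDim d Δ)) = tens d p ⊤ ⊓ tens d q ⊤ := by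
  ext x
  simp [mem_tens_top, forall_and]

theorem map_iota_tens {S : Type*} (d : S → ℕ) {Γ Δ : List S} (p : QLat (listDim d Γ))
    (q : QLat (listDim d Δ)) :
    (tens d p q).map (iota d (Γ ++ Δ)) = p.map (iota d Γ) * q.map (iota d Δ) := by
  apply le_antisymm
  · rw [tens, Submodule.map_span_le]
    rintro _ ⟨x, hx, y, hy, rfl⟩
    rw [iota_tensVec]
    exact Submodule.mul_mem_mul (Submodule.mem_map_of_mem hx) (Submodule.mem_map_of_mem hy)
  · rw [Submodule.mul_le]
    rintro _ ⟨x, hx, rfl⟩ _ ⟨y, hy, rfl⟩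
    rw [← iota_tensVec]
    exact Submodule.mem_map_of_mem (Submodule.subset_span ⟨x, hx, y, hy, rfl⟩)

theorem tens_top_top {S : Type*} (d : S → ℕ) {Γ Δ : List S} :
    tens d (⊤ : QLat (listDim d Γ)) (⊤ : QLat (listDim d Δ)) = ⊤ :=
  eq_top_iff.2 fun _ _ => (mem_tens_top d).2 fun _ => trivial

theorem range_iota_append {S : Type*} (d : S → ℕ) (Γ Δ : List S) :
    LinearMap.range (iota d (Γ ++ Δ)) =
      LinearMap.range (iota d Γ) * LinearMap.range (iota d Δ) := by
  simp only [LinearMap.range_eq_map]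
  rw [← map_iota_tens, tens_top_top]

/-! ### Operators on polynomials -/

open Classical in
/-- The operator `T ⊗ Id` on polynomials, where `T` acts on the variables in `Γ`. -/
noncomputable def extendOp {S : Type*} (d : S → ℕ) {Γ Γ' : List S}
    (T : Hilb (listDim d Γ) →ₗ[ℂ] Hilb (listDim d Γ')) :
    MvPolynomial S ℂ →ₗ[ℂ] MvPolynomial S ℂ :=
  (basisMonomials S ℂ).constr ℂ fun m =>
    -- For distinct s-nodes, the argument of `T` is the basis vector with the exponents of `m` on
    -- `Γ` as coordinates, or zero if no index has these coordinates.
    iota d Γ' (T (WithLp.toLp 2 fun i =>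
      coeff (coords d Γ i) (monomial (m.filter (· ∈ Γ)) (1 : ℂ)))) *
      monomial (m.filter (· ∉ Γ)) 1

open Classical in
theorem extendOp_monomial {S : Type*} (d : S → ℕ) {Γ Γ' : List S}
    (T : Hilb (listDim d Γ) →ₗ[ℂ] Hilb (listDim d Γ')) (m : S →₀ ℕ) :
    extendOp d T (monomial m 1) =
      iota d Γ' (T (WithLp.toLp 2 fun i =>
        coeff (coords d Γ i) (monomial (m.filter (· ∈ Γ)) (1 : ℂ)))) *
        monomial (m.filter (· ∉ Γ)) 1 := by
  simpa [extendOp] using (basisMonomials S ℂ).constr_basis ℂ _ m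

/-- Monomials over `Λ` have no variable in `Γ`, so they stay entirely in the factor that `T` does
not touch. -/
theorem extendOp_iota_mul {S : Type*} (d : S → ℕ) {Γ Γ' Λ : List S}
    (T : Hilb (listDim d Γ) →ₗ[ℂ] Hilb (listDim d Γ')) (h : List.Disjoint Γ Λ)
    (y : Hilb (listDim d Λ)) (g : MvPolynomial S ℂ) :
    extendOp d T (iota d Λ y * g) = iota d Λ y * extendOp d T g := by
  classical
  suffices H : (LinearMap.mul ℂ (MvPolynomial S ℂ)).compr₂ (extendOp d T) ∘ₗ iota d Λ =
      (LinearMap.mul ℂ (MvPolynomial S ℂ)).compl₂ (extendOp d T) ∘ₗ iota d Λ from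
    DFunLike.congr_fun (DFunLike.congr_fun H y) g
  refine (EuclideanSpace.basisFun _ ℂ).toBasis.ext fun k => ?_
  refine (basisMonomials S ℂ).ext fun m => ?_
  have h1 : (coords d Λ k).filter (· ∈ Γ) = 0 := by
    ext s
    by_cases hs : s ∈ Γ
    · simpa [hs] using coords_eq_zero d Λ k (h hs)
    · simp [hs]
  have h2 : (coords d Λ k).filter (· ∉ Γ) = coords d Λ k := by
    ext s
    by_cases hs : s ∈ Γ
    · simpa [hs] using (coords_eq_zero d Λ k (h hs)).symm
    · simp [hs]
  have h3 : (1 : ℂ) = 1 * 1 := by simp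
  simp only [LinearMap.comp_apply, OrthonormalBasis.coe_toBasis, EuclideanSpace.basisFun_apply,
    iota_single, coe_basisMonomials, LinearMap.compr₂_apply, LinearMap.compl₂_apply,
    LinearMap.mul_apply', monomial_mul, mul_one, extendOp_monomial, Finsupp.filter_add, h1, h2,
    zero_add]
  nth_rw 2 [h3]
  rw [← monomial_mul, mul_left_comm]

theorem extendOp_iota {S : Type*} (d : S → ℕ) {Γ Γ' : List S} (hΓ : Γ.Nodup)
    (T : Hilb (listDim d Γ) →ₗ[ℂ] Hilb (listDim d Γ')) (x : Hilb (listDim d Γ)) :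
    extendOp d T (iota d Γ x) = iota d Γ' (T x) := by
  classical
  suffices H : extendOp d T ∘ₗ iota d Γ = iota d Γ' ∘ₗ T from DFunLike.congr_fun H x
  refine (EuclideanSpace.basisFun _ ℂ).toBasis.ext fun k => ?_
  have h1 : (coords d Γ k).filter (· ∈ Γ) = coords d Γ k := by
    ext s
    by_cases hs : s ∈ Γ
    · simp [hs]
    · simpa [hs] using (coords_eq_zero d Γ k hs).symm
  have h2 : (coords d Γ k).filter (· ∉ Γ) = 0 := by
    ext s
    by_cases hs : s ∈ Γ
    · simp [hs]
    · simpa [hs] using coords_eq_zero d Γ k hs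
  have h3 : (WithLp.toLp 2 fun i : Fin (listDim d Γ) =>
      coeff (coords d Γ i) (monomial (coords d Γ k) (1 : ℂ))) =
      EuclideanSpace.single k (1 : ℂ) := by
    ext i
    simp only [← iota_single, coeff_iota d hΓ]
  simp only [LinearMap.comp_apply, OrthonormalBasis.coe_toBasis, EuclideanSpace.basisFun_apply,
    iota_single, extendOp_monomial, h1, h2, h3]
  simp

theorem iota_tensId {S : Type*} (d : S → ℕ) {Γ Γ' Δ : List S} (h : (Γ ++ Δ).Nodup)
    (T : Hilb (listDim d Γ) →ₗ[ℂ] Hilb (listDim d Γ')) (x : Hilb (listDim d (Γ ++ Δ))) :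
    iota d (Γ' ++ Δ) (tensId d T Δ x) = extendOp d T (iota d (Γ ++ Δ) x) := by
  rw [List.nodup_append'] at h
  suffices H : iota d (Γ' ++ Δ) ∘ₗ tensId d T Δ = extendOp d T ∘ₗ iota d (Γ ++ Δ) from
    DFunLike.congr_fun H x
  refine hilb_append_ext d fun x y => ?_
  simp only [LinearMap.comp_apply, tensId_tensVec, iota_tensVec]
  rw [mul_comm, mul_comm (iota d Γ x), extendOp_iota_mul d T h.2.2, extendOp_iota d h.1]

theorem map_extendOp_mul_range {S : Type*} (d : S → ℕ) {Γ Γ' Λ : List S}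
    (T : Hilb (listDim d Γ) →ₗ[ℂ] Hilb (listDim d Γ')) (h : List.Disjoint Γ Λ)
    (P : Submodule ℂ (MvPolynomial S ℂ)) :
    (P * LinearMap.range (iota d Λ)).map (extendOp d T) =
      P.map (extendOp d T) * LinearMap.range (iota d Λ) := by
  apply le_antisymm
  · rw [Submodule.map_le_iff_le_comap, Submodule.mul_le]
    rintro x hx _ ⟨y, rfl⟩
    rw [Submodule.mem_comap, mul_comm x, extendOp_iota_mul d T h, mul_comm (iota d Λ y)]
    exact Submodule.mul_mem_mul (Submodule.mem_map_of_mem hx) ⟨y, rfl⟩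
  · rw [Submodule.mul_le]
    rintro _ ⟨x, hx, rfl⟩ _ ⟨y, rfl⟩
    rw [mul_comm (extendOp d T x), ← extendOp_iota_mul d T h, mul_comm (iota d Λ y)]
    exact Submodule.mem_map_of_mem (Submodule.mul_mem_mul hx ⟨y, rfl⟩)

/-- Operators acting on disjoint sets of s-nodes commute. -/
theorem extendOp_comm {S : Type*} (d : S → ℕ) {Γ Γ' Λ Λ' Δ : List S}
    (T : Hilb (listDim d Γ) →ₗ[ℂ] Hilb (listDim d Γ'))
    (U : Hilb (listDim d Λ) →ₗ[ℂ] Hilb (listDim d Λ'))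
    (h : (Γ ++ (Λ ++ Δ)).Nodup) (hT : List.Disjoint Γ Λ') (hU : List.Disjoint Λ Γ')
    (x : Hilb (listDim d (Γ ++ (Λ ++ Δ)))) :
    extendOp d T (extendOp d U (iota d (Γ ++ (Λ ++ Δ)) x)) =
      extendOp d U (extendOp d T (iota d (Γ ++ (Λ ++ Δ)) x)) := by
  have h' : (Λ ++ Δ).Nodup ∧ Γ.Nodup ∧ Γ.Disjoint (Λ ++ Δ) := by
    rw [List.nodup_append'] at h
    exact ⟨h.2.1, h.1, h.2.2⟩
  obtain ⟨h1, h2, h3⟩ := h'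
  obtain ⟨h4, h5⟩ := List.disjoint_append_right.1 h3
  suffices H : extendOp d T ∘ₗ extendOp d U ∘ₗ iota d (Γ ++ (Λ ++ Δ)) =
      extendOp d U ∘ₗ extendOp d T ∘ₗ iota d (Γ ++ (Λ ++ Δ)) from DFunLike.congr_fun H x
  refine hilb_append_ext d fun x w => ?_
  simp only [LinearMap.comp_apply, iota_tensVec]
  -- Each operator moves past the factor that it does not act on; the image of `w` under `U` is
  -- first rewritten as a vector over `Λ' ++ Δ`, which is disjoint from `Γ`.
  rw [extendOp_iota_mul d U h4.symm, mul_comm (iota d Γ x) (iota d (Λ ++ Δ) w),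
    extendOp_iota_mul d T h3, extendOp_iota d h2, mul_comm _ (iota d Γ' _),
    extendOp_iota_mul d U hU, ← iota_tensId d h1, mul_comm (iota d Γ x),
    extendOp_iota_mul d T (List.disjoint_append_right.2 ⟨hT, h5⟩), extendOp_iota d h2, mul_comm]

end

/-! ### Measurements as linear maps -/

theorem sasaki_eq_map {n : ℕ} (p q : QLat n) :
    sasaki p q = p.map q.starProjection.toLinearMap := by
  ext x
  constructor
  · rintro ⟨hq, hx⟩
    obtain ⟨y, hy, z, hz, rfl⟩ := Submodule.mem_sup.1 hx
    refine ⟨y, hy, ?_⟩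
    have h1 := Submodule.starProjection_eq_self_iff.2 hq
    rwa [map_add, (Submodule.starProjection_apply_eq_zero_iff q).2 hz, add_zero] at h1
  · rintro ⟨y, hy, rfl⟩
    refine ⟨Submodule.starProjection_apply_mem _ _, ?_⟩
    have h := Submodule.sub_mem _ (Submodule.mem_sup_left hy : y ∈ p ⊔ qᗮ)
      (Submodule.mem_sup_right (q.sub_starProjection_mem_orthogonal y))
    rwa [sub_sub_cancel] at h

theorem inner_eq_sum_tensSlice {S : Type*} (d : S → ℕ) {Γ Δ : List S}
    (x y : Hilb (listDim d (Γ ++ Δ))) :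
    inner ℂ x y = ∑ j, inner ℂ (tensSlice d Γ Δ j x) (tensSlice d Γ Δ j y) := by
  simp only [PiLp.inner_apply]
  rw [← (pairIdx d Γ Δ).sum_comp, Fintype.sum_prod_type_right]
  rfl

/-- The inner product is the sum of those of the slices, so projecting every slice onto `q` leaves a
remainder orthogonal to `q ⊗ ⊤`. -/
theorem starProjection_tens_top {S : Type*} (d : S → ℕ) {Γ Δ : List S} (q : QLat (listDim d Γ)) :
    (tens d q (⊤ : QLat (listDim d Δ))).starProjection.toLinearMap =
      tensId d q.starProjection.toLinearMap Δ := by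
  ext1 x
  refine Submodule.eq_starProjection_of_mem_orthogonal ?_ ?_
  · refine (mem_tens_top d).2 fun j => ?_
    rw [tensSlice_tensId]
    exact Submodule.starProjection_apply_mem _ _
  · refine (Submodule.mem_orthogonal _ _).2 fun z hz => ?_
    rw [inner_eq_sum_tensSlice]
    refine Finset.sum_eq_zero fun j _ => ?_
    rw [map_sub, tensSlice_tensId]
    exact (Submodule.mem_orthogonal _ _).1 (q.sub_starProjection_mem_orthogonal _) _
      ((mem_tens_top d).1 hz j)

/-- The identification of `ℂᵐ` with `ℂⁿ` when `m = n`. -/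
noncomputable def castLin {m n : ℕ} (h : m = n) : Hilb m →ₗ[ℂ] Hilb n :=
  (LinearIsometryEquiv.piLpCongrLeft 2 ℂ ℂ (finCongr h)).toLinearEquiv.toLinearMap

theorem castLin_apply {m n : ℕ} (h : m = n) (x : Hilb m) (k : Fin n) :
    castLin h x k = x (Fin.cast h.symm k) := by
  subst h
  rfl

theorem tensId_castLin_comp {S : Type*} (d : S → ℕ) {Γ Γ' : List S}
    (h : listDim d Γ = listDim d Γ') (T : Hilb (listDim d Γ) →ₗ[ℂ] Hilb (listDim d Γ))
    (Δ : List S) :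
    tensId d (castLin h ∘ₗ T) Δ = castLin (listDim_append_congr d h Δ) ∘ₗ tensId d T Δ := by
  refine hilb_append_ext d fun x y => ?_
  simp only [LinearMap.comp_apply, tensId_tensVec]
  ext k
  obtain ⟨⟨a, b⟩, rfl⟩ := (pairIdx d Γ' Δ).surjective k
  -- The numerical value of a paired index depends only on the two indices and on `d(Δ)`.
  have hk : Fin.cast (listDim_append_congr d h Δ).symm (pairIdx d Γ' Δ (a, b)) =
      pairIdx d Γ Δ (Fin.cast h.symm a, b) := by
    ext
    rfl
  rw [castLin_apply, hk]
  simp [tensVec, castLin_apply]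

/-- The linear map carried by an o-node: the unitary operator, or the orthogonal projection. -/
noncomputable def Operation.toLin {m n : ℕ} : Operation m n → Hilb m →ₗ[ℂ] Hilb n
  | .unitary U => U.toLinearEquiv.toLinearMap
  | .mes h p => castLin h ∘ₗ p.starProjection.toLinearMap

theorem recast_sasaki_tens_top {S : Type*} (d : S → ℕ) {Γ Γ' Δ : List S}
    (h : listDim d Γ = listDim d Γ') (q : QLat (listDim d Γ)) (p : QLat (listDim d (Γ ++ Δ))) :
    recast (listDim_append_congr d h Δ) (sasaki p (tens d q ⊤)) =
      p.map (tensId d (castLin h ∘ₗ q.starProjection.toLinearMap) Δ) := by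
  rw [tensId_castLin_comp, Submodule.map_comp, ← starProjection_tens_top, ← sasaki_eq_map]
  rfl

/-! ### Swaps and permutations -/

theorem iota_swapOp {S : Type*} (d : S → ℕ) (Γ Δ Ξ : List S)
    (x : Hilb (listDim d (Γ ++ Δ ++ Ξ))) :
    iota d (Δ ++ Γ ++ Ξ) (swapOp d Γ Δ Ξ x) = iota d (Γ ++ Δ ++ Ξ) x := by
  rw [iota_apply, iota_apply, ← (swapIdx d Γ Δ Ξ).sum_comp]
  refine Finset.sum_congr rfl fun k _ => ?_
  rw [coords_swapIdx]
  simp [swapOp, LinearIsometryEquiv.piLpCongrLeft_apply, Equiv.piCongrLeft']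

theorem SwapPath.iota_apply {S : Type*} {d : S → ℕ} {Γ Γ' : List S}
    {σ : Hilb (listDim d Γ) ≃ₗᵢ[ℂ] Hilb (listDim d Γ')} (h : SwapPath d Γ Γ' σ)
    (x : Hilb (listDim d Γ)) : iota d Γ' (σ x) = iota d Γ x := by
  induction h with
  | nil => rfl
  | step Δ Ξ Θ σ _ ih => rw [LinearIsometryEquiv.trans_apply, iota_swapOp, ih]

theorem SwapPath.map_iota {S : Type*} {d : S → ℕ} {Γ Γ' : List S}
    {σ : Hilb (listDim d Γ) ≃ₗᵢ[ℂ] Hilb (listDim d Γ')} (h : SwapPath d Γ Γ' σ)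
    (p : QLat (listDim d Γ)) :
    (p.map σ.toLinearEquiv.toLinearMap).map (iota d Γ') = p.map (iota d Γ) := by
  rw [← Submodule.map_comp]
  congr 1
  ext1 x
  exact h.iota_apply x

theorem SwapPath.trans {S : Type*} {d : S → ℕ} {Γ Γ' Γ'' : List S}
    {σ : Hilb (listDim d Γ) ≃ₗᵢ[ℂ] Hilb (listDim d Γ')}
    {τ : Hilb (listDim d Γ') ≃ₗᵢ[ℂ] Hilb (listDim d Γ'')}
    (h : SwapPath d Γ Γ' σ) (h' : SwapPath d Γ' Γ'' τ) : SwapPath d Γ Γ'' (σ.trans τ) := by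
  induction h' with
  | nil => exact h
  | step Δ Ξ Θ τ _ ih => exact SwapPath.step Δ Ξ Θ _ ih

theorem exists_swapPath_swap {S : Type*} (d : S → ℕ) (Γ Δ Ξ : List S) :
    ∃ σ, SwapPath d (Γ ++ Δ ++ Ξ) (Δ ++ Γ ++ Ξ) σ :=
  ⟨_, SwapPath.step Γ Δ Ξ _ SwapPath.nil⟩

theorem List.Perm.exists_swapPath {S : Type*} (d : S → ℕ) {Γ Γ' : List S} (h : Γ.Perm Γ') :
    ∃ σ, SwapPath d Γ Γ' σ := by
  -- A block swap only exchanges blocks at the head of the list; the prefix `L` lets the induction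
  -- reach interior positions.
  suffices H : ∀ L : List S, ∃ σ, SwapPath d (L ++ Γ) (L ++ Γ') σ from H []
  induction h with
  | nil => exact fun L => ⟨_, SwapPath.nil⟩
  | @cons x l₁ l₂ _ ih =>
    intro L
    rw [List.append_cons L x l₁, List.append_cons L x l₂]
    exact ih (L ++ [x])
  | swap x y l =>
    intro L
    -- Bring the pair to the front, exchange it there, and move it back behind `L`.
    obtain ⟨σ₁, h₁⟩ := exists_swapPath_swap d L [y, x] l
    obtain ⟨σ₂, h₂⟩ := exists_swapPath_swap d [y] [x] (L ++ l)
    obtain ⟨σ₃, h₃⟩ := exists_swapPath_swap d [x, y] L l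
    have h : ∃ σ, SwapPath d (L ++ [y, x] ++ l) (L ++ [x, y] ++ l) σ :=
      ⟨_, (h₁.trans h₂).trans h₃⟩
    rwa [List.append_assoc, List.append_assoc] at h
  | trans _ _ ih₁ ih₂ =>
    intro L
    obtain ⟨σ₁, h₁⟩ := ih₁ L
    obtain ⟨σ₂, h₂⟩ := ih₂ L
    exact ⟨_, h₁.trans h₂⟩

theorem List.Perm.range_iota {S : Type*} (d : S → ℕ) {Γ Γ' : List S} (h : Γ.Perm Γ') :
    LinearMap.range (iota d Γ) = LinearMap.range (iota d Γ') := by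
  obtain ⟨σ, hσ⟩ := h.exists_swapPath d
  rw [LinearMap.range_eq_map, LinearMap.range_eq_map, ← hσ.map_iota,
    Submodule.map_top, LinearEquiv.range]

/-- Products of submodules need not distribute over meets; here they do because `iota` is injective
and `p ↦ p ⊗ ⊤` preserves meets. -/
theorem map_iota_inf_mul_range {S : Type*} (d : S → ℕ) {Γ Δ : List S} (h : (Γ ++ Δ).Nodup)
    (p q : QLat (listDim d Γ)) :
    (p ⊓ q).map (iota d Γ) * LinearMap.range (iota d Δ) =
      p.map (iota d Γ) * LinearMap.range (iota d Δ) ⊓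
        q.map (iota d Γ) * LinearMap.range (iota d Δ) := by
  simp only [LinearMap.range_eq_map, ← map_iota_tens]
  rw [← Submodule.map_inf _ (iota_injective d h), tens_inf_top]

theorem map_iota_tensId {S : Type*} (d : S → ℕ) {Γ Γ' Δ : List S} (h : (Γ ++ Δ).Nodup)
    (T : Hilb (listDim d Γ) →ₗ[ℂ] Hilb (listDim d Γ')) (p : QLat (listDim d (Γ ++ Δ))) :
    (p.map (tensId d T Δ)).map (iota d (Γ' ++ Δ)) =
      (p.map (iota d (Γ ++ Δ))).map (extendOp d T) := by
  rw [← Submodule.map_comp, ← Submodule.map_comp]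
  congr 1
  ext1 x
  exact iota_tensId d h T x

/-! ### Slices around an o-node -/

namespace QCircuit

variable {S O : Type*} {C : QCircuit S O}

theorem IsSlice.perm {Γ Γ' : List S} (h : C.IsSlice Γ) (hp : Γ.Perm Γ') : C.IsSlice Γ' :=
  ⟨hp.nodup_iff.1 h.1, fun a ha b hb => h.2 a (hp.mem_iff.2 ha) b (hp.mem_iff.2 hb)⟩

theorem arrow_inputs {o : O} {s : S} (hs : s ∈ C.inputs o) {x : S ⊕ O}
    (h : Arrow C.inputs C.outputs (Sum.inl s) x) : x = Sum.inr o := by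
  cases h with
  | into _ o' hs' => rw [C.inputs_unique s o o' hs hs']

/-- Whatever lies strictly after an input of an o-node lies after that o-node. -/
theorem Past.of_inputs {o : O} {s : S} (hs : s ∈ C.inputs o) {x : S ⊕ O}
    (h : C.Past (Sum.inl s) x) (hne : Sum.inl s ≠ x) : C.Past (Sum.inr o) x := by
  rcases Relation.ReflTransGen.cases_head h with h | ⟨y, hy, h⟩
  · exact absurd h hne
  · rwa [arrow_inputs hs hy] at h

theorem Past.exists_output {o : O} {t : S} (h : C.Past (Sum.inr o) (Sum.inl t)) :
    ∃ s ∈ C.outputs o, C.Past (Sum.inl s) (Sum.inl t) := by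
  rcases Relation.ReflTransGen.cases_head h with h | ⟨y, hy, h⟩
  · cases h
  · cases hy with
    | out _ s hs => exact ⟨s, hs, h⟩

theorem past_of_inputs_outputs {o : O} {s t : S} (hs : s ∈ C.inputs o) (ht : t ∈ C.outputs o) :
    C.Past (Sum.inl s) (Sum.inl t) :=
  (Relation.ReflTransGen.single (Arrow.into s o hs)).tail (Arrow.out o t ht)

theorem exists_output (C : QCircuit S O) (o : O) : ∃ t, t ∈ C.outputs o :=
  List.exists_mem_of_ne_nil _ (C.outputs_ne_nil o)

/-- Replacing the outputs of an o-node by its inputs turns slices into slices. -/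
theorem IsSlice.inputs_append {o : O} {Δ : List S} (h : C.IsSlice (C.outputs o ++ Δ)) :
    C.IsSlice (C.inputs o ++ Δ) := by
  obtain ⟨t, ht⟩ := C.exists_output o
  obtain ⟨hn, hc⟩ := h
  have hd := (List.nodup_append'.1 hn).2.2
  have key : ∀ a ∈ C.outputs o, ∀ b ∈ Δ,
      ¬ C.Past (Sum.inl a) (Sum.inl b) ∧ ¬ C.Past (Sum.inl b) (Sum.inl a) := by
    intro a ha b hb
    have hne : a ≠ b := fun h => hd ha (h ▸ hb)
    exact ⟨hc a (by simp [ha]) b (by simp [hb]) hne, hc b (by simp [hb]) a (by simp [ha]) hne.symm⟩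
  refine ⟨List.nodup_append'.2 ⟨C.inputs_nodup o, (List.nodup_append'.1 hn).2.1, ?_⟩, ?_⟩
  · intro a ha hb
    exact (key t ht a hb).2 (past_of_inputs_outputs ha ht)
  · intro a ha b hb hne hp
    have hne' : (Sum.inl a : S ⊕ O) ≠ Sum.inl b := fun h => hne (Sum.inl_injective h)
    -- A path between two inputs gives a cycle through `o`; one from an input to `Δ` passes through
    -- an output; one from `Δ` to an input extends to the output `t`.
    rcases List.mem_append.1 ha with ha | ha <;> rcases List.mem_append.1 hb with hb | hb
    · exact C.acyclic _ (Relation.TransGen.tail' (Past.of_inputs ha hp hne') (Arrow.into b o hb))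
    · obtain ⟨s, hs, hsb⟩ := (Past.of_inputs ha hp hne').exists_output
      exact (key s hs b hb).1 hsb
    · exact (key t ht a ha).2 (hp.trans (past_of_inputs_outputs hb ht))
    · exact hc a (by simp [ha]) b (by simp [hb]) hne hp

theorem outputs_disjoint {o o' : O} (h : o ≠ o') :
    List.Disjoint (C.outputs o) (C.outputs o') :=
  fun s hs hs' => h (C.outputs_unique s o o' hs hs')

/-! ### Verification in polynomial terms -/

/-- The linear map carried by an o-node of a circuit. -/
noncomputable def lin (C : QCircuit S O) (o : O) :
    Hilb (C.sdim (C.inputs o)) →ₗ[ℂ] Hilb (C.sdim (C.outputs o)) :=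
  (C.op o).toLin

/-- The action of an o-node on polynomials over the s-nodes. -/
noncomputable def act (C : QCircuit S O) (o : O) :
    MvPolynomial S ℂ →ₗ[ℂ] MvPolynomial S ℂ :=
  extendOp C.dim (C.lin o)

/-- The space of the polynomials that come from vectors of `p`. -/
noncomputable def poly (C : QCircuit S O) (Γ : List S) (p : QLat (C.sdim Γ)) :
    Submodule ℂ (MvPolynomial S ℂ) :=
  p.map (iota C.dim Γ)

theorem recast_sasaki_eq_map_lin {o : O} {h : C.sdim (C.inputs o) = C.sdim (C.outputs o)}
    {q : QLat (C.sdim (C.inputs o))} (ho : C.op o = Operation.mes h q) (Δ : List S)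
    (p : QLat (C.sdim (C.inputs o ++ Δ))) :
    recast (listDim_append_congr C.dim h Δ) (sasaki p (_root_.tens C.dim q ⊤)) =
      p.map (tensId C.dim (C.lin o) Δ) := by
  rw [recast_sasaki_tens_top, lin, ho, Operation.toLin]

theorem Verifies.isSlice {Γ : List S} {p : QLat (C.sdim Γ)} (h : C.Verifies Γ p) :
    C.IsSlice Γ := by
  induction h with
  | top _ h => exact h
  | ord _ _ _ _ _ ih => exact ih
  | meet _ _ _ _ _ ih => exact ih
  | swap Γ Δ Ξ _ _ ih => exact ih.perm (List.perm_append_comm.append_right Ξ)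
  | sas _ _ _ _ _ _ _ h => exact h
  | uni _ _ _ _ _ _ _ h => exact h
  | tens _ _ _ _ h => exact h

/-- Merges the rules for measurements and unitaries into one, so that later arguments need not
distinguish them. -/
theorem Verifies.step {o : O} {Δ : List S} {p : QLat (C.sdim (C.inputs o ++ Δ))}
    (hv : C.Verifies (C.inputs o ++ Δ) p) (hs : C.IsSlice (C.outputs o ++ Δ)) :
    C.Verifies (C.outputs o ++ Δ) (p.map (tensId C.dim (C.lin o) Δ)) := by
  cases ho : C.op o with
  | unitary U =>
    have h := Verifies.uni _ _ Δ p U (IsUni.intro o U ho) hv hs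
    simpa only [lin, ho] using! h
  | mes h q =>
    rw [← recast_sasaki_eq_map_lin ho]
    exact Verifies.sas _ _ Δ p q (IsMes.intro o h q ho) hv hs

theorem Verifies.map_swapPath {Γ Γ' : List S} {p : QLat (C.sdim Γ)} (hv : C.Verifies Γ p)
    {σ : Hilb (C.sdim Γ) ≃ₗᵢ[ℂ] Hilb (C.sdim Γ')} (hσ : SwapPath C.dim Γ Γ' σ) :
    C.Verifies Γ' (p.map σ.toLinearEquiv.toLinearMap) := by
  induction hσ with
  | nil => simpa using! hv
  | step Δ Ξ Θ σ _ ih =>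
    have h := Verifies.swap _ _ _ _ ih
    rw [← Submodule.map_comp] at h
    exact h

/-- The epistemic state is below whatever is verified at the same s-nodes in another order. -/
theorem Verifies.poly_k_le {Γ Γ' : List S} {p : QLat (C.sdim Γ)} (hv : C.Verifies Γ p)
    (h : Γ.Perm Γ') : C.poly Γ' (C.k Γ') ≤ C.poly Γ p := by
  obtain ⟨σ, hσ⟩ := h.exists_swapPath C.dim
  rw [poly, poly, ← hσ.map_iota]
  exact Submodule.map_mono (sInf_le (hv.map_swapPath hσ))

theorem verifies_k {Γ : List S} (h : C.IsSlice Γ) : C.Verifies Γ (C.k Γ) :=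
  (C.isLeast_k Γ h).1

theorem poly_tens_top {Γ Δ : List S} (p : QLat (C.sdim Γ)) :
    C.poly (Γ ++ Δ) (_root_.tens C.dim p ⊤) = C.poly Γ p * LinearMap.range (iota C.dim Δ) := by
  rw [poly, map_iota_tens, LinearMap.range_eq_map, poly]

theorem poly_lin {o : O} {Δ : List S} (h : C.IsSlice (C.inputs o ++ Δ))
    (p : QLat (C.sdim (C.inputs o ++ Δ))) :
    C.poly (C.outputs o ++ Δ) (p.map (tensId C.dim (C.lin o) Δ)) =
      (C.poly (C.inputs o ++ Δ) p).map (C.act o) :=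
  map_iota_tensId C.dim h.1 _ p

/-! ### The induction on verification -/

/-- `C.Bounds o A q`: in every slice containing the outputs of `o` and `A`, the epistemic state
just before `o`, transformed by `o`, is below `q` at `A`. -/
def Bounds (C : QCircuit S O) (o : O) (A : List S) (q : QLat (C.sdim A)) : Prop :=
  -- Both lists are quantified because the induction changes them: passing an o-node alters `Δ`, and
  -- the tensor rule enlarges `B`.
  ∀ Δ B : List S, C.IsSlice (C.outputs o ++ Δ) → (A ++ B).Perm (C.outputs o ++ Δ) →
    (C.poly (C.inputs o ++ Δ) (C.k (C.inputs o ++ Δ))).map (C.act o) ≤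
      C.poly A q * LinearMap.range (iota C.dim B)

/-- No induction hypothesis is needed: `q ⊗ ⊤` is itself verified just before `o`, so it bounds the
epistemic state there. -/
theorem Verifies.bounds_step_self {o : O} {Ξ : List S} {q : QLat (C.sdim (C.inputs o ++ Ξ))}
    (hv : C.Verifies (C.inputs o ++ Ξ) q) :
    C.Bounds o (C.outputs o ++ Ξ) (q.map (tensId C.dim (C.lin o) Ξ)) := by
  intro Δ B hs hp
  rw [List.append_assoc, List.perm_append_left_iff] at hp
  have hs' : C.IsSlice (C.inputs o ++ Ξ ++ B) := by
    rw [List.append_assoc]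
    exact hs.inputs_append.perm (hp.symm.append_left _)
  have hd : List.Disjoint (C.inputs o) B :=
    (List.disjoint_append_left.1 (List.nodup_append'.1 hs'.1).2.2).1
  rw [poly_lin hv.isSlice, act, ← map_extendOp_mul_range C.dim _ hd, ← poly_tens_top]
  refine Submodule.map_mono ((Verifies.tens _ B _ hv hs').poly_k_le ?_)
  rw [List.append_assoc]
  exact hp.append_left _

theorem Verifies.bounds_step {o u : O} (hne : o ≠ u) {Ξ : List S}
    {q : QLat (C.sdim (C.inputs u ++ Ξ))} (hv : C.Verifies (C.inputs u ++ Ξ) q)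
    (hq : C.Bounds o (C.inputs u ++ Ξ) q) :
    C.Bounds o (C.outputs u ++ Ξ) (q.map (tensId C.dim (C.lin u) Ξ)) := by
  classical
  intro Δ B hs hp
  rw [List.append_assoc] at hp
  have hou : List.Disjoint (C.outputs o) (C.outputs u) := outputs_disjoint hne
  have hsub : ∀ s ∈ C.outputs u, s ∈ Δ := fun s hs =>
    (List.mem_append.1 (hp.mem_iff.1 (List.mem_append_left _ hs))).resolve_left
      fun h => hou h hs
  -- `Θ` is the part of `Δ` untouched by `u`; the four slices below take either side of `o` and
  -- either side of `u`.
  obtain ⟨Θ, hΘ⟩ : ∃ Θ, Δ.Perm (C.outputs u ++ Θ) := by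
    obtain ⟨l, hl, hl'⟩ := List.subperm_of_subset (C.outputs_nodup u) hsub
    obtain ⟨Θ, hΘ⟩ := hl'.exists_perm_append
    exact ⟨Θ, hΘ.trans (hl.append_right _)⟩
  have comm : ∀ X Y : List S, (X ++ (Y ++ Θ)).Perm (Y ++ (X ++ Θ)) :=
    fun X Y => List.perm_append_comm_assoc X Y Θ
  have hs₁ : C.IsSlice (C.outputs o ++ (C.outputs u ++ Θ)) := hs.perm (hΘ.append_left _)
  have hs₂ : C.IsSlice (C.outputs o ++ (C.inputs u ++ Θ)) :=
    (hs₁.perm (comm _ _)).inputs_append.perm (comm _ _)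
  have hs₃ : C.IsSlice (C.inputs o ++ (C.outputs u ++ Θ)) := hs₁.inputs_append
  have hs₄ : C.IsSlice (C.inputs o ++ (C.inputs u ++ Θ)) := hs₂.inputs_append
  have hp' : (Ξ ++ B).Perm (C.outputs o ++ Θ) := by
    rw [← List.perm_append_left_iff (C.outputs u)]
    exact (hp.trans (hΘ.append_left _)).trans (comm _ _)
  have hp₂ : (C.inputs u ++ Ξ ++ B).Perm (C.outputs o ++ (C.inputs u ++ Θ)) := by
    rw [List.append_assoc]
    exact (hp'.append_left _).trans (comm _ _)
  have hd : List.Disjoint (C.inputs u) B :=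
    (List.disjoint_append_left.1 (List.nodup_append'.1 (hs₂.perm hp₂.symm).1).2.2).1
  have hd₁ : List.Disjoint (C.inputs o) (C.outputs u) :=
    (List.disjoint_append_right.1 (List.nodup_append'.1 hs₃.1).2.2).1
  have hd₂ : List.Disjoint (C.inputs u) (C.outputs o) :=
    (List.disjoint_append_right.1 (List.nodup_append'.1 hs₂.1).2.2).1.symm
  rw [poly_lin hv.isSlice, act, act, ← map_extendOp_mul_range C.dim _ hd, ← act, ← act]
  have hs₅ := hs₄.perm (comm _ _)
  -- Applying `u` to the epistemic state before both o-nodes gives something verified just after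
  -- `u`, hence above the epistemic state there.
  have h₁ : C.poly (C.inputs o ++ Δ) (C.k (C.inputs o ++ Δ)) ≤
      (C.poly _ (C.k (C.inputs o ++ (C.inputs u ++ Θ)))).map (C.act u) := by
    have h := ((verifies_k hs₅).step (hs₃.perm (comm _ _))).poly_k_le
      ((comm _ _).trans (hΘ.symm.append_left (C.inputs o)))
    rw [poly_lin hs₅] at h
    exact h.trans (Submodule.map_mono ((verifies_k hs₄).poly_k_le (comm _ _)))
  refine (Submodule.map_mono h₁).trans (le_trans ?_ (Submodule.map_mono (hq _ B hs₂ hp₂)))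
  rintro _ ⟨_, ⟨_, ⟨x, hx, rfl⟩, rfl⟩, rfl⟩
  exact ⟨_, ⟨_, ⟨x, hx, rfl⟩, rfl⟩, (extendOp_comm C.dim _ _ hs₄.1 hd₁ hd₂ x).symm⟩

theorem Verifies.bounds_outputs (o u : O) {Ξ : List S} {q : QLat (C.sdim (C.inputs u ++ Ξ))}
    (hv : C.Verifies (C.inputs u ++ Ξ) q) (hq : C.Bounds o (C.inputs u ++ Ξ) q) :
    C.Bounds o (C.outputs u ++ Ξ) (q.map (tensId C.dim (C.lin u) Ξ)) := by
  by_cases h : o = u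
  · subst h
    exact hv.bounds_step_self
  · exact hv.bounds_step h hq

theorem Verifies.bounds (o : O) {A : List S} {q : QLat (C.sdim A)} (hv : C.Verifies A q) :
    C.Bounds o A q := by
  induction hv with
  | top A hA =>
    intro Δ B hs hp
    rw [← poly_lin hs.inputs_append, poly, poly, ← LinearMap.range_eq_map, ← range_iota_append,
      hp.range_iota]
    exact LinearMap.map_le_range
  | ord A p q hv hpq ih =>
    exact fun Δ B hs hp => (ih Δ B hs hp).trans
      (mul_le_mul' (Submodule.map_mono hpq) le_rfl)
  | meet A p q hvp hvq ihp ihq =>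
    intro Δ B hs hp
    have h := map_iota_inf_mul_range C.dim (hs.perm hp.symm).1 p q
    exact (le_inf (ihp Δ B hs hp) (ihq Δ B hs hp)).trans h.ge
  | swap Γ Θ Ξ p hv ih =>
    intro Δ B hs hp
    have h := (SwapPath.step (d := C.dim) Γ Θ Ξ _ SwapPath.nil).map_iota p
    have hp' := ((List.perm_append_comm (l₁ := Γ) (l₂ := Θ)).append_right Ξ).append_right B
    exact (ih Δ B hs (hp'.trans hp)).trans (le_of_eq (congrArg (· * _) h.symm))
  | sas Γ Γ' Ξ p q h hv hs ih =>
    cases h with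
    | intro u h q hu =>
      rw [recast_sasaki_eq_map_lin hu]
      exact hv.bounds_outputs o u ih
  | uni Γ Γ' Ξ p U h hv hs ih =>
    cases h with
    | intro u U hu =>
      have h := hv.bounds_outputs o u ih
      simpa only [lin, hu] using! h
  | tens Γ Ξ p hv hs ih =>
    intro Δ B hs' hp
    rw [poly_tens_top, mul_assoc, ← range_iota_append]
    -- The factor `⊤` over `Ξ` is absorbed into the complement `B`.
    exact ih Δ (Ξ ++ B) hs' (by rwa [← List.append_assoc])

/-! ### Conclusion -/

theorem perm_of_support_eq {Γ Γ' : List S} (h : Γ.Nodup) (h' : Γ'.Nodup)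
    (hs : support Γ = support Γ') : Γ.Perm Γ' :=
  (List.perm_ext_iff_of_nodup h h').2 fun a => Set.ext_iff.1 hs a

theorem exists_append_isSlice {Γ A Ξ : List S} (hΓ : Γ.Nodup) (hA : A.Nodup)
    (hΞ : C.IsSlice Ξ) (h : support Γ ∪ support A ⊆ support Ξ) :
    ∃ Δ, C.IsSlice (Γ ++ Δ) ∧ support (Γ ++ Δ) = support Γ ∪ support A := by
  classical
  have hsupp : support (Γ ++ A.filter (· ∉ Γ)) = support Γ ∪ support A := by
    ext s
    by_cases hs : s ∈ Γ <;> simp [support, hs]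
  refine ⟨A.filter (· ∉ Γ), ⟨List.nodup_append'.2 ⟨hΓ, hA.filter _, ?_⟩, ?_⟩, hsupp⟩
  · intro s hs hs'
    simp [hs] at hs'
  · intro a ha b hb
    exact hΞ.2 a (h (hsupp.subset ha)) b (h (hsupp.subset hb))

end QCircuit

theorem mainTheorem4 {S O : Type*} (C : QCircuit S O) (Γ Γ' A : List S) (p : QLat (C.sdim Γ))
    (hmes : C.IsMes Γ' Γ p) (hA : C.IsSlice A) (hcomp : C.Compatible Γ' A) :
    (∃ Δ B : List S, C.IsSlice (Γ' ++ Δ) ∧ C.IsSlice (A ++ B) ∧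
      QCircuit.support (Γ' ++ Δ) = QCircuit.support Γ' ∪ QCircuit.support A ∧
      QCircuit.support (A ++ B) = QCircuit.support Γ' ∪ QCircuit.support A) ∧
    ∀ Δ B : List S, C.IsSlice (Γ' ++ Δ) → C.IsSlice (A ++ B) →
      QCircuit.support (Γ' ++ Δ) = QCircuit.support Γ' ∪ QCircuit.support A →
      QCircuit.support (A ++ B) = QCircuit.support Γ' ∪ QCircuit.support A →
      C.IsSlice (Γ ++ Δ) ∧
      (∃ σ, SwapPath C.dim (A ++ B) (Γ' ++ Δ) σ) ∧
      ∀ σ, SwapPath C.dim (A ++ B) (Γ' ++ Δ) σ →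
        ∀ q : QLat (C.sdim A), C.Verifies A q →
          recast (hmes.sdim_append_eq Δ) (sasaki (C.k (Γ ++ Δ)) (tens C.dim p ⊤)) ≤
            (tens C.dim q ⊤).map σ.toLinearEquiv.toLinearMap := by
  cases hmes with
  | intro o h p ho =>
  obtain ⟨Ξ, hΞ, hsub⟩ := hcomp
  constructor
  · obtain ⟨Δ, hΔ, hΔ'⟩ := QCircuit.exists_append_isSlice (C.outputs_nodup o) hA.1 hΞ hsub
    obtain ⟨B, hB, hB'⟩ := QCircuit.exists_append_isSlice hA.1 (C.outputs_nodup o) hΞ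
      (by rwa [Set.union_comm])
    exact ⟨Δ, B, hΔ, hB, hΔ', by rwa [Set.union_comm (QCircuit.support (C.outputs o))]⟩
  · intro Δ B hΔ hB hΔ' hB'
    have hp := QCircuit.perm_of_support_eq hB.1 hΔ.1 (hB'.trans hΔ'.symm)
    refine ⟨hΔ.inputs_append, hp.exists_swapPath C.dim, fun σ hσ q hq => ?_⟩
    -- Injectivity of `iota` allows comparison in the polynomial ring, where `σ` disappears whatever
    -- the sequence of swaps.
    rw [QCircuit.recast_sasaki_eq_map_lin ho,
      ← Submodule.map_le_map_iff_of_injective (iota_injective C.dim hΔ.1), hσ.map_iota]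
    have h := hq.bounds o Δ B hΔ hp
    rwa [← QCircuit.poly_lin hΔ.inputs_append, ← QCircuit.poly_tens_top] at h
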